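/- Let $0<\theta<1$ and $\theta<p\le 1$. **Definitions.** Let $G$ be a directed graph (at most one arc for each ordered pair of vertices) with all in- and out-degrees finite. For a vertex $v_0$ let $\Upsilon(G,v_0)$ be the set of infinite directed paths in $G$ that start at $v_0$ and tend to infinity, i.e. visit every vertex at most finitely many times, with its Borel $\sigma$-algebra (product topology). $G$ admits random paths with exponential intersection tails with parameter $\theta$, in short EIT$(\theta)$, if for some vertex $v_0$ there are a Borel probability measure $\mu$ on $\Upsilon(G,v_0)$ and a constant $C$ such that $$\mu\times\mu\,\{(\varphi,\psi): |\varphi\cap\psi|\ge n\}\le C\theta^n\qquad\text{for all } n\ge 0,$$ where $|\varphi\cap\psi|$ is the number of directed edges that belong to both $\varphi$ and $\psi$. $G$ admits random paths with vertex-EIT$(\theta)$ if the same holds with $|\varphi\cap\psi|$ replaced by the number of vertices common to $\varphi$ and $\psi$. For a locally finite undirected simple graph the definitions are the same, with undirected paths, and with undirected edges in place of directed edges. In oriented bond (respectively site) percolation with parameter $p$ on $G$ each edge (respectively vertex) is independently open with probability $p$ and closed otherwise; a path is open if all its edges (respectively vertices) are open. The directed open cluster $\mathcal C(v)$ of a vertex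 $v$ (an open vertex, for site percolation) is the union of all directed open paths emanating from $v$. On an undirected graph, $\mathcal C(v)$ is the ordinary open cluster of $v$. A subgraph is transient if, orientations ignored, it is connected and simple random walk on it is a transient Markov chain. **Proposition.** 1. If a directed graph $G$ admits random paths with EIT$(\theta)$, then in oriented bond percolation on $G$ with parameter $p$, with probability 1 there is a vertex $v$ such that $\mathcal C(v)$ is transient. 2. If a directed graph $G$ admits random paths with vertex-EIT$(\theta)$, then in oriented site percolation on $G$ with parameter $p$, with probability 1 there is an open vertex $v$ such that $\mathcal C(v)$ is transient. 3. If an undirected graph $G$ admits random (undirected) paths with EIT$(\theta)$, then in ordinary bond percolation on $G$ with parameter $p$, with probability 1 some open cluster is transient. 4. If an undirected graph $G$ admits random (undirected) paths with vertex-EIT$(\theta)$, then in ordinary site percolation on $G$ with parameter $p$, with probability 1 some open cluster is transient. -/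

import Mathlib

open MeasureTheory ProbabilityTheory
open scoped ENNReal unitInterval

namespace PathPercolation

variable {V : Type*}

/-! ### Simple random walk and transience -/

/-- A subgraph of a directed graph on `V`: a set of vertices, and a set of arcs between them. -/
structure Subdigraph (V : Type*) where
  verts : Set V
  Adj : V → V → Prop
  fst_mem : ∀ {a b : V}, Adj a b → a ∈ verts
  snd_mem : ∀ {a b : V}, Adj a b → b ∈ verts

namespace Subdigraph

/-- The neighbors of `x` when the orientations of the arcs are ignored. -/
def neighbors (H : Subdigraph V) (x : V) : Set V := {y | H.Adj x y ∨ H.Adj y x}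

/-- `H` is connected when the orientations of the arcs are ignored. -/
def Connected (H : Subdigraph V) : Prop :=
  H.verts.Nonempty ∧ ∀ x ∈ H.verts, ∀ y ∈ H.verts,
    Relation.ReflTransGen (fun a b => b ∈ H.neighbors a) x y

open Classical in
/-- The law of one step of simple random walk on `H` (orientations ignored) from `x`: uniform on
the neighbors of `x`. At a vertex without neighbors the walk stays put (as it does, by convention,
where there are infinitely many neighbors, so that no uniform law exists). -/
noncomputable def walkStep (H : Subdigraph V) (x : V) : PMF V :=
  if h : (H.neighbors x).Finite ∧ (H.neighbors x).Nonempty then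
    PMF.uniformOfFinset h.1.toFinset (h.1.toFinset_nonempty.2 h.2)
  else PMF.pure x

open Classical in
/-- The probability that simple random walk on `H` started at `x` visits `o` at one of the times
`0, 1, …, n`, computed by conditioning on the first step. -/
noncomputable def hitProb (H : Subdigraph V) (o : V) : ℕ → V → ℝ≥0∞
  | 0, x => if x = o then 1 else 0
  | n + 1, x => if x = o then 1 else ∑' y, H.walkStep x y * H.hitProb o n y

/-- The probability that simple random walk on `H` started at `o` returns to `o` at some time
`≥ 1`: the increasing limit of the probabilities of a return at one of the times `1, …, n + 1`. -/
noncomputable def returnProb (H : Subdigraph V) (o : V) : ℝ≥0∞ :=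
  ⨆ n, ∑' y, H.walkStep o y * H.hitProb o n y

/-- `H` is transient: orientations ignored, it is connected and simple random walk on it is a
transient Markov chain, i.e. the walk from any vertex fails to return with positive probability. -/
def Transient (H : Subdigraph V) : Prop :=
  H.Connected ∧ ∀ o ∈ H.verts, H.returnProb o < 1

end Subdigraph

/-! ### Open clusters -/

/-- The cluster of `v` in the digraph `D`: the union of all directed paths of `D` emanating
from `v` (including the path of length `0`). -/
def cluster (D : Digraph V) (v : V) : Subdigraph V where
  verts := {a | Relation.ReflTransGen D.Adj v a}
  Adj a b := Relation.ReflTransGen D.Adj v a ∧ D.Adj a b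
  fst_mem h := h.1
  snd_mem h := h.1.tail h.2

/-- The arcs of a digraph. -/
def arcs (G : Digraph V) : Set (V × V) := {e | G.Adj e.1 e.2}

/-- The digraph of the arcs of `G` that are open in the bond configuration `ω`. -/
def openArcs (G : Digraph V) (ω : Set (V × V)) : Digraph V where
  Adj a b := G.Adj a b ∧ (a, b) ∈ ω

/-- The arcs of `G` both of whose ends are open in the site configuration `ω`. -/
def openSites (G : Digraph V) (ω : Set V) : Digraph V where
  Adj a b := G.Adj a b ∧ a ∈ ω ∧ b ∈ ω

/-- An undirected graph, with each edge replaced by the two arcs between its ends. -/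
def bidirected (G : SimpleGraph V) : Digraph V where
  Adj := G.Adj

/-- The (bidirected) graph of the edges of `G` that are open in the bond configuration `ω`. -/
def openEdges (G : SimpleGraph V) (ω : Set (Sym2 V)) : Digraph V where
  Adj a b := G.Adj a b ∧ s(a, b) ∈ ω

/-- All vertices have finite degree. -/
def LocFinite (G : Digraph V) : Prop :=
  ∀ v, {w | G.Adj v w}.Finite ∧ {w | G.Adj w v}.Finite

/-! ### Measures on paths with exponential intersection tails -/

/-- The infinite directed paths in `G` that emanate from `v₀` and tend to infinity, i.e. visit any
vertex at most finitely many times; a path is given by the sequence of its vertices. -/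
def PathsToInfinity (G : Digraph V) (v₀ : V) : Type _ :=
  {φ : ℕ → V // φ 0 = v₀ ∧ (∀ n, G.Adj (φ n) (φ (n + 1))) ∧ ∀ v, {n | φ n = v}.Finite}

/-- The σ-algebra generated by the coordinates `φ ↦ φ n`, with `V` discrete. As `φ n` takes only
countably many values when `G` is locally finite, it is the Borel σ-algebra of the product
topology. -/
instance (G : Digraph V) (v₀ : V) : MeasurableSpace (PathsToInfinity G v₀) :=
  ⨆ n : ℕ, MeasurableSpace.comap (fun φ => φ.1 n) ⊤

/-- The set of arcs of a path. -/
def pathArcs (φ : ℕ → V) : Set (V × V) := Set.range fun n => (φ n, φ (n + 1))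

/-- The set of undirected edges of a path. -/
def pathEdges (φ : ℕ → V) : Set (Sym2 V) := Set.range fun n => s(φ n, φ (n + 1))

/-- The set of vertices of a path. -/
def pathVerts (φ : ℕ → V) : Set V := Set.range φ

/-- `μ` has exponential intersection tails with parameter `θ`, the intersection of two paths
being measured through their sets `tr φ` of arcs, edges or vertices. -/
def HasEIT {α : Type*} {G : Digraph V} {v₀ : V} (tr : (ℕ → V) → Set α)
    (μ : Measure (PathsToInfinity G v₀)) (θ : ℝ) : Prop :=
  ∃ C : ℝ, ∀ n : ℕ,
    (μ.prod μ) {q | (n : ℕ∞) ≤ (tr q.1.1 ∩ tr q.2.1).encard} ≤ ENNReal.ofReal (C * θ ^ n)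

/-- `G` admits random paths with exponential intersection tails of parameter `θ`. -/
def AdmitsEIT {α : Type*} (G : Digraph V) (tr : (ℕ → V) → Set α) (θ : ℝ) : Prop :=
  ∃ (v₀ : V) (μ : Measure (PathsToInfinity G v₀)), IsProbabilityMeasure μ ∧ HasEIT tr μ θ

end PathPercolation

/-!
The four cases have a common form: percolation acts on labels `t a b` of the arcs `(a, b)` of `G`,
where the label is the arc itself, the edge `s(a, b)`, or, for site percolation, the vertex `a`.

*Transience.* If the value at `o` of every finitely supported function `g` satisfies
`g o ^ 2 ≤ C * energy g`, then the walk is transient (`Subdigraph.PosCapacity.returnProb_lt_one`):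
for the function "probability of hitting `o` within time `n`" summation by parts bounds the energy
by a multiple of the probability of not returning, uniformly in `n`. This property spreads along
edges, so it suffices to check it at the root `v` of a cluster (`cluster_transient`). There it
follows from a measure on open paths from `v` to infinity: along each path the gradient of `g` sums
to at least `|g v|`, and the Cauchy–Schwarz inequality shows that `(|g v| * mass) ^ 2` is at most the
energy of `g` times the sum over the labels `a` of the squared measure of the paths through `a`
(`sq_mul_openMass_le`). The latter sum is called the energy of the measure.

*Percolation.* The law `μ` of the random path, weighted by
`p ^ (-|S|)` if the set `S` of labels that the path uses after time `k` in a finite ball is open,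
and by `0` otherwise, is such a measure up to the boundary of the ball. Its mass has mean `1`, and
both the variance of the mass and the mean of its energy are at most the `μ × μ`-mean of
`J * p ^ (-J)`, where `J` is the number of common labels of two paths after time `k`
(`setBernoulli_openMass_bad_le`). By the intersection tails this mean is finite uniformly in the
ball, as `θ < p`. It tends to `0` as `k → ∞` by dominated convergence, because two paths to infinity
with finitely many common labels have none after some time (`tendsto_tsum_tailMeet`).

Hence, with probability close to `1` for large `k`, the mass is at least `1 / 2` and the energy at
most `1` in arbitrarily large balls, and then one of the finitely many vertices that can be reached
in `k` steps has a transient cluster (`exists_transient_of_frequently`). Letting `k → ∞` gives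
probability `1` directly, without a zero-one law; the event that no cluster is transient need not be
known to be measurable, as only its outer measure is bounded.
-/

namespace PathPercolation

open Filter Topology

variable {V : Type*}

/-! ### A Dirichlet-form criterion for transience -/

namespace Subdigraph

theorem mem_neighbors_comm {H : Subdigraph V} {x y : V} :
    y ∈ H.neighbors x ↔ x ∈ H.neighbors y := by
  simp only [neighbors, Set.mem_ofPred_eq]
  exact or_comm

/-- The Dirichlet energy of a function `g` supported in `F`, as a sum over the ordered pairs of
neighbors `(x, y)` with `x ∈ F`. An edge with both ends in `F` is counted twice and an edge with
only one end in `F` once, so for such `g` this agrees with the usual energy up to a factor `2`. -/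
noncomputable def energy (H : Subdigraph V) (hfin : ∀ x, (H.neighbors x).Finite)
    (F : Finset V) (g : V → ℝ) : ℝ :=
  ∑ x ∈ F, ∑ y ∈ (hfin x).toFinset, (g x - g y) ^ 2

theorem energy_nonneg (H : Subdigraph V) (hfin : ∀ x, (H.neighbors x).Finite)
    (F : Finset V) (g : V → ℝ) : 0 ≤ H.energy hfin F g :=
  Finset.sum_nonneg fun _ _ => Finset.sum_nonneg fun _ _ => sq_nonneg _

/-- Summation by parts. -/
theorem energy_le_two_mul (H : Subdigraph V) (hfin : ∀ x, (H.neighbors x).Finite)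
    (F : Finset V) (g : V → ℝ) (hg : ∀ x ∉ F, g x = 0) :
    H.energy hfin F g ≤ 2 * ∑ x ∈ F, ∑ y ∈ (hfin x).toFinset, g x * (g x - g y) := by
  classical
  have hswap : ∑ x ∈ F, ∑ y ∈ (hfin x).toFinset, g y * (g y - g x)
      ≤ ∑ x ∈ F, ∑ y ∈ (hfin x).toFinset, g x * (g x - g y) := by
    calc ∑ x ∈ F, ∑ y ∈ (hfin x).toFinset, g y * (g y - g x)
        = ∑ x ∈ F, ∑ y ∈ (hfin x).toFinset with y ∈ F, g y * (g y - g x) := by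
          refine Finset.sum_congr rfl fun x _ => (Finset.sum_filter_of_ne ?_).symm
          intro y _ hy
          by_contra hyF
          exact hy (by simp [hg y hyF])
      _ = ∑ y ∈ F, ∑ x ∈ (hfin y).toFinset with x ∈ F, g y * (g y - g x) := by
          refine Finset.sum_comm' fun x y => ?_
          simp only [Finset.mem_filter, Set.Finite.mem_toFinset]
          rw [mem_neighbors_comm]
          tauto
      _ ≤ _ := by
          refine Finset.sum_le_sum fun y _ => ?_
          refine Finset.sum_le_sum_of_subset_of_nonneg (Finset.filter_subset _ _) ?_
          intro x hx hxF
          have : x ∉ F := fun h => hxF (Finset.mem_filter.2 ⟨hx, h⟩)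
          rw [hg x this]
          nlinarith [sq_nonneg (g y)]
  have : H.energy hfin F g = ∑ x ∈ F, ∑ y ∈ (hfin x).toFinset, g x * (g x - g y)
      + ∑ x ∈ F, ∑ y ∈ (hfin x).toFinset, g y * (g y - g x) := by
    simp only [energy, ← Finset.sum_add_distrib]
    refine Finset.sum_congr rfl fun x _ => Finset.sum_congr rfl fun y _ => by ring
  linarith

theorem sq_sub_le_energy (H : Subdigraph V) (hfin : ∀ x, (H.neighbors x).Finite)
    (F : Finset V) (g : V → ℝ) (hg : ∀ x ∉ F, g x = 0) {x y : V} (hxy : y ∈ H.neighbors x) :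
    (g x - g y) ^ 2 ≤ H.energy hfin F g := by
  have key : ∀ a b, a ∈ F → b ∈ H.neighbors a → (g a - g b) ^ 2 ≤ H.energy hfin F g := by
    intro a b ha hb
    calc (g a - g b) ^ 2 ≤ ∑ y ∈ (hfin a).toFinset, (g a - g y) ^ 2 :=
          Finset.single_le_sum (f := fun y => (g a - g y) ^ 2) (fun _ _ => sq_nonneg _)
            ((hfin a).mem_toFinset.2 hb)
      _ ≤ _ := Finset.single_le_sum
            (f := fun x => ∑ y ∈ (hfin x).toFinset, (g x - g y) ^ 2)
            (fun _ _ => Finset.sum_nonneg fun _ _ => sq_nonneg _) ha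
  by_cases hx : x ∈ F
  · exact key x y hx hxy
  by_cases hy : y ∈ F
  · have := key y x hy (mem_neighbors_comm.1 hxy)
    nlinarith
  · rw [hg x hx, hg y hy]
    simpa using energy_nonneg H hfin F g

/-- The vertex `o` has positive capacity: the value at `o` of a finitely supported function is
controlled by its Dirichlet energy. -/
def PosCapacity (H : Subdigraph V) (hfin : ∀ x, (H.neighbors x).Finite) (o : V) : Prop :=
  ∃ C : ℝ, ∀ (F : Finset V) (g : V → ℝ), (∀ x ∉ F, g x = 0) → g o ^ 2 ≤ C * H.energy hfin F g

theorem PosCapacity.of_neighbor {H : Subdigraph V} {hfin : ∀ x, (H.neighbors x).Finite} {x y : V}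
    (hx : H.PosCapacity hfin x) (hxy : y ∈ H.neighbors x) : H.PosCapacity hfin y := by
  obtain ⟨C, hC⟩ := hx
  refine ⟨2 * C + 2, fun F g hg => ?_⟩
  have h1 := hC F g hg
  have h2 := sq_sub_le_energy H hfin F g hg hxy
  nlinarith [sq_nonneg (2 * g x - g y)]

theorem tsum_walkStep_mul (H : Subdigraph V) {x : V} (hfin : (H.neighbors x).Finite)
    (hne : (H.neighbors x).Nonempty) (f : V → ℝ≥0∞) :
    ∑' y, H.walkStep x y * f y = (∑ y ∈ hfin.toFinset, f y) / hfin.toFinset.card := by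
  classical
  have hw : ∀ y, H.walkStep x y = if y ∈ hfin.toFinset then (hfin.toFinset.card : ℝ≥0∞)⁻¹ else 0 := by
    intro y
    rw [walkStep, dif_pos ⟨hfin, hne⟩, PMF.uniformOfFinset_apply]
  rw [tsum_eq_sum (s := hfin.toFinset), ENNReal.div_eq_inv_mul, Finset.mul_sum]
  · exact Finset.sum_congr rfl fun y hy => by rw [hw, if_pos hy]
  · intro y hy
    rw [hw, if_neg hy, zero_mul]

theorem tsum_walkStep_mul_of_not_nonempty (H : Subdigraph V) {x : V}
    (hne : ¬ (H.neighbors x).Nonempty) (f : V → ℝ≥0∞) :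
    ∑' y, H.walkStep x y * f y = f x := by
  classical
  rw [walkStep, dif_neg (fun h => hne h.2), tsum_eq_single x]
  · simp
  · intro y hy
    simp [PMF.pure_apply, hy]

theorem hitProb_self (H : Subdigraph V) (o : V) (n : ℕ) : H.hitProb o n o = 1 := by
  cases n <;> simp [hitProb]

theorem hitProb_le_one (H : Subdigraph V) (o : V) (n : ℕ) (x : V) : H.hitProb o n x ≤ 1 := by
  induction n generalizing x with
  | zero => simp only [hitProb]; split_ifs <;> simp
  | succ n ih =>
    simp only [hitProb]
    split_ifs
    · exact le_rfl
    · calc ∑' y, H.walkStep x y * H.hitProb o n y ≤ ∑' y, H.walkStep x y :=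
            ENNReal.tsum_le_tsum fun y => mul_le_of_le_one_right' (ih y)
        _ = 1 := PMF.tsum_coe _

theorem hitProb_le_succ (H : Subdigraph V) (o : V) (n : ℕ) (x : V) :
    H.hitProb o n x ≤ H.hitProb o (n + 1) x := by
  induction n generalizing x with
  | zero => simp only [hitProb]; split_ifs <;> simp
  | succ n ih =>
    rw [hitProb, hitProb]
    split_ifs
    · exact le_rfl
    · exact ENNReal.tsum_le_tsum fun y => mul_le_mul_right (ih y) _

theorem exists_finset_hitProb_eq_zero (H : Subdigraph V) (hfin : ∀ x, (H.neighbors x).Finite)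
    (o : V) (n : ℕ) : ∃ F : Finset V, ∀ x ∉ F, H.hitProb o n x = 0 := by
  classical
  induction n with
  | zero =>
    refine ⟨{o}, fun x hx => ?_⟩
    rw [hitProb, if_neg (by simpa using hx)]
  | succ n ih =>
    obtain ⟨F, hF⟩ := ih
    refine ⟨insert o (F ∪ F.biUnion fun x => (hfin x).toFinset), fun x hx => ?_⟩
    simp only [Finset.mem_insert, Finset.mem_union, Finset.mem_biUnion, Set.Finite.mem_toFinset,
      not_or, not_exists, not_and] at hx
    obtain ⟨hxo, hxF, hx⟩ := hx
    rw [hitProb, if_neg hxo]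
    by_cases hne : (H.neighbors x).Nonempty
    · rw [tsum_walkStep_mul H (hfin x) hne, Finset.sum_eq_zero, ENNReal.zero_div]
      intro y hy
      by_contra h0
      exact hx y (by_contra fun h => h0 (hF y h))
        (mem_neighbors_comm.1 ((hfin x).mem_toFinset.1 hy))
    · rw [tsum_walkStep_mul_of_not_nonempty H hne, hF x hxF]

/-- Hitting probabilities within a bounded time are subharmonic away from the target. -/
theorem sum_hitProb_sub_nonpos (H : Subdigraph V) (hfin : ∀ x, (H.neighbors x).Finite)
    (o : V) (n : ℕ) {x : V} (hx : x ≠ o) :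
    ∑ y ∈ (hfin x).toFinset, ((H.hitProb o n x).toReal - (H.hitProb o n y).toReal) ≤ 0 := by
  have hfinite : ∀ n y, H.hitProb o n y ≠ ∞ := fun n y =>
    ((H.hitProb_le_one o n y).trans_lt ENNReal.one_lt_top).ne
  cases n with
  | zero =>
    refine Finset.sum_nonpos fun y _ => ?_
    rw [hitProb, if_neg hx]
    simp
  | succ n =>
    by_cases hne : (H.neighbors x).Nonempty
    · have hcard : ((hfin x).toFinset.card : ℝ) ≠ 0 := by
        rw [Nat.cast_ne_zero, Finset.card_ne_zero]
        exact (hfin x).toFinset_nonempty.2 hne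
      have h1 : (H.hitProb o (n + 1) x).toReal
          = (∑ y ∈ (hfin x).toFinset, (H.hitProb o n y).toReal) / (hfin x).toFinset.card := by
        rw [hitProb, if_neg hx, tsum_walkStep_mul H (hfin x) hne, ENNReal.toReal_div,
          ENNReal.toReal_sum fun y _ => hfinite n y, ENNReal.toReal_natCast]
      rw [Finset.sum_sub_distrib, Finset.sum_const, nsmul_eq_mul, h1, mul_div_cancel₀ _ hcard,
        sub_nonpos]
      exact Finset.sum_le_sum fun y _ =>
        ENNReal.toReal_mono (hfinite _ _) (H.hitProb_le_succ o n y)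
    · rw [Set.not_nonempty_iff_eq_empty] at hne
      simp [hne]

/-- Positive capacity implies transience: tested on the probability of hitting `o` within time
`n`, it bounds the probability of a return by time `n + 1` away from `1`, uniformly in `n`. -/
theorem PosCapacity.returnProb_lt_one {H : Subdigraph V} {hfin : ∀ x, (H.neighbors x).Finite}
    {o : V} (ho : H.PosCapacity hfin o) : H.returnProb o < 1 := by
  classical
  obtain ⟨C, hC⟩ := ho
  by_cases hne : (H.neighbors o).Nonempty
  swap
  · have := hC {o} (fun x => if x = o then 1 else 0) (by simp +contextual)
    rw [Set.not_nonempty_iff_eq_empty] at hne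
    norm_num [energy, hne] at this
  have hfinite : ∀ n y, H.hitProb o n y ≠ ∞ := fun n y =>
    ((H.hitProb_le_one o n y).trans_lt ENNReal.one_lt_top).ne
  set d : ℝ := ((hfin o).toFinset.card : ℝ) with hd
  have hd0 : 0 < d := by
    rw [hd, Nat.cast_pos, Finset.card_pos]
    exact (hfin o).toFinset_nonempty.2 hne
  have hbound : ∀ n, 1 ≤ |C| * 2 * d * (1 - (∑' y, H.walkStep o y * H.hitProb o n y).toReal) := by
    intro n
    obtain ⟨F, hF⟩ := H.exists_finset_hitProb_eq_zero hfin o n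
    set u : V → ℝ := fun x => (H.hitProb o n x).toReal with hu
    have huo : u o = 1 := by simp [hu, hitProb_self]
    have hu0 : ∀ x ∉ F, u x = 0 := fun x hx => by simp [hu, hF x hx]
    have hoF : o ∈ F := by
      by_contra h
      simpa [huo] using hu0 o h
    have h1 := hC F u hu0
    have h2 := energy_le_two_mul H hfin F u hu0
    have h3 : ∑ x ∈ F, ∑ y ∈ (hfin x).toFinset, u x * (u x - u y)
        ≤ ∑ y ∈ (hfin o).toFinset, (1 - u y) := by
      rw [← Finset.add_sum_erase F _ hoF, huo]
      have : ∑ x ∈ F.erase o, ∑ y ∈ (hfin x).toFinset, u x * (u x - u y) ≤ 0 := by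
        refine Finset.sum_nonpos fun x hx => ?_
        rw [← Finset.mul_sum]
        exact mul_nonpos_of_nonneg_of_nonpos ENNReal.toReal_nonneg
          (sum_hitProb_sub_nonpos H hfin o n (Finset.ne_of_mem_erase hx))
      simpa using this
    have h4 : ∑ y ∈ (hfin o).toFinset, (1 - u y)
        = d * (1 - (∑' y, H.walkStep o y * H.hitProb o n y).toReal) := by
      rw [tsum_walkStep_mul H (hfin o) hne, ENNReal.toReal_div,
        ENNReal.toReal_sum fun y _ => hfinite n y, ENNReal.toReal_natCast, ← hd,
        mul_sub, mul_div_cancel₀ _ hd0.ne', Finset.sum_sub_distrib]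
      simp [hd, hu]
    have h5 := energy_nonneg H hfin F u
    rw [huo] at h1
    calc (1 : ℝ) ≤ C * H.energy hfin F u := by linarith
      _ ≤ |C| * H.energy hfin F u := mul_le_mul_of_nonneg_right (le_abs_self C) h5
      _ ≤ |C| * (2 * (d * (1 - (∑' y, H.walkStep o y * H.hitProb o n y).toReal))) :=
          mul_le_mul_of_nonneg_left (by linarith) (abs_nonneg C)
      _ = _ := by ring
  have hK : 0 < |C| * 2 * d := by
    rcases (abs_nonneg C).eq_or_lt with h | h
    · have := hbound 0
      rw [← h] at this
      norm_num at this
    · positivity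
  have hle : H.returnProb o ≤ ENNReal.ofReal (1 - 1 / (|C| * 2 * d)) := by
    refine iSup_le fun n => ?_
    have hne' : ∑' y, H.walkStep o y * H.hitProb o n y ≠ ∞ := by
      refine ((ENNReal.tsum_le_tsum fun y =>
        mul_le_of_le_one_right' (H.hitProb_le_one o n y)).trans_lt ?_).ne
      rw [PMF.tsum_coe]
      exact ENNReal.one_lt_top
    rw [← ENNReal.ofReal_toReal hne']
    refine ENNReal.ofReal_le_ofReal ?_
    have : 1 / (|C| * 2 * d) ≤ 1 - (∑' y, H.walkStep o y * H.hitProb o n y).toReal := by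
      rw [div_le_iff₀ hK]
      linarith [hbound n]
    linarith
  refine hle.trans_lt ?_
  rw [ENNReal.ofReal_lt_one]
  have : 0 < 1 / (|C| * 2 * d) := by positivity
  linarith

end Subdigraph

theorem neighbors_cluster_finite {G D : Digraph V} (hG : LocFinite G)
    (hD : ∀ a b, D.Adj a b → G.Adj a b) (v x : V) : ((cluster D v).neighbors x).Finite :=
  ((hG x).1.union (hG x).2).subset fun _ hy => hy.imp (fun h => hD _ _ h.2) (fun h => hD _ _ h.2)

/-- The cluster of `v` is connected, and positive capacity spreads from `v` along open paths. -/
theorem cluster_transient {D : Digraph V} {v : V}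
    {hfin : ∀ x, ((cluster D v).neighbors x).Finite}
    (hv : (cluster D v).PosCapacity hfin v) : (cluster D v).Transient := by
  have hreach : ∀ x, Relation.ReflTransGen D.Adj v x →
      Relation.ReflTransGen (fun a b => b ∈ (cluster D v).neighbors a) v x ∧
        (cluster D v).PosCapacity hfin x := by
    intro x hx
    induction hx with
    | refl => exact ⟨.refl, hv⟩
    | tail hab hbc ih =>
      have : _ ∈ (cluster D v).neighbors _ := Or.inl ⟨hab, hbc⟩
      exact ⟨ih.1.tail this, ih.2.of_neighbor this⟩
  have hsymm : Std.Symm (fun a b => b ∈ (cluster D v).neighbors a) :=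
    ⟨fun _ _ h => Subdigraph.mem_neighbors_comm.1 h⟩
  refine ⟨⟨⟨v, .refl⟩, fun x hx y hy => ?_⟩, fun o ho => (hreach o ho).2.returnProb_lt_one⟩
  exact (Std.Symm.symm _ _ (hreach x hx).1).trans (hreach y hy).1

/-! ### Variation of a function along a path -/

/-- The oscillation of `g` along a path is bounded by a sum over the *set* of its labels, even if
the path passes several times through the same arc: loops can be skipped. The label `t a b` of an
arc is assumed to determine the tail of the arc up to the choice between its two ends. -/
theorem abs_sub_le_sum_labels {α : Type*} [DecidableEq α] {t : V → V → α}
    (ht : ∀ a b c d, t a b = t c d → a = c ∨ a = d) (g : V → ℝ) (m : α → ℝ) (hm : ∀ a, 0 ≤ m a)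
    (N : ℕ) (φ : ℕ → V) (hφ : ∀ j < N, |g (φ j) - g (φ (j + 1))| ≤ m (t (φ j) (φ (j + 1)))) :
    |g (φ 0) - g (φ N)| ≤ ∑ a ∈ (Finset.range N).image (fun j => t (φ j) (φ (j + 1))), m a := by
  induction N using Nat.strong_induction_on generalizing φ with
  | _ N ih =>
  rcases Nat.eq_zero_or_pos N with rfl | hN
  · simp
  by_cases hret : ∃ k, 0 < k ∧ k ≤ N ∧ φ k = φ 0
  · obtain ⟨k, hk0, hkN, hk⟩ := hret
    have h := ih (N - k) (by omega) (fun j => φ (k + j))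
      (fun j hj => by simpa [add_assoc] using hφ (k + j) (by omega))
    simp only [add_zero, hk, Nat.add_sub_cancel' hkN] at h
    refine h.trans (Finset.sum_le_sum_of_subset_of_nonneg ?_ fun a _ _ => hm a)
    intro a ha
    simp only [Finset.mem_image, Finset.mem_range] at ha ⊢
    obtain ⟨j, hj, rfl⟩ := ha
    exact ⟨k + j, by omega, by simp [add_assoc]⟩
  · push Not at hret
    have h := ih (N - 1) (by omega) (fun j => φ (j + 1)) (fun j hj => hφ (j + 1) (by omega))
    simp only [zero_add, Nat.sub_add_cancel hN] at h
    have hnot : t (φ 0) (φ 1) ∉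
        (Finset.range (N - 1)).image (fun j => t (φ (j + 1)) (φ (j + 1 + 1))) := by
      simp only [Finset.mem_image, Finset.mem_range, not_exists, not_and]
      intro j hj heq
      rcases ht _ _ _ _ heq.symm with h | h
      · exact hret (j + 1) (by omega) (by omega) h.symm
      · exact hret (j + 1 + 1) (by omega) (by omega) h.symm
    have hsub : insert (t (φ 0) (φ 1))
        ((Finset.range (N - 1)).image (fun j => t (φ (j + 1)) (φ (j + 1 + 1))))
        ⊆ (Finset.range N).image (fun j => t (φ j) (φ (j + 1))) := by
      intro a ha
      simp only [Finset.mem_insert, Finset.mem_image, Finset.mem_range] at ha ⊢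
      rcases ha with rfl | ⟨j, hj, rfl⟩
      · exact ⟨0, hN, rfl⟩
      · exact ⟨j + 1, by omega, rfl⟩
    refine le_trans ?_ (Finset.sum_le_sum_of_subset_of_nonneg hsub fun a _ _ => hm a)
    rw [Finset.sum_insert hnot]
    exact (abs_sub_le _ (g (φ 1)) _).trans (add_le_add (hφ 0 hN) h)

/-! ### Weighted counts of open sets under Bernoulli percolation -/

theorem measurableSet_subset_config {α : Type*} (S : Finset α) :
    MeasurableSet {ω : Set α | (S : Set α) ⊆ ω} := by
  have : {ω : Set α | (S : Set α) ⊆ ω} = ⋂ a ∈ S, {ω : Set α | a ∈ ω} := by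
    ext ω
    simp [Set.subset_def]
  rw [this]
  exact Finset.measurableSet_biInter _ fun a _ => measurableSet_setOfPred.2 (measurable_set_mem a)

theorem setBernoulli_superset {α : Type*} {u : Set α} (p : unitInterval) (S : Finset α)
    (hS : (S : Set α) ⊆ u) :
    (setBernoulli u p).real {ω | (S : Set α) ⊆ ω} = (p : ℝ) ^ S.card := by
  have hpre : (fun q : α → Prop => {i | q i}) ⁻¹' {ω | (S : Set α) ⊆ ω}
      = Set.pi S fun _ => {True} := by
    ext q
    simp [Set.subset_def, Set.mem_pi]
  rw [measureReal_def, setBernoulli_apply', hpre, Measure.infinitePi_pi _ (fun _ _ => .of_discrete)]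
  rw [Finset.prod_congr rfl (g := fun _ => (unitInterval.toNNReal p : ℝ≥0∞))]
  · simp
  · intro i hi
    have : i ∈ u := hS hi
    simp [this]

open Classical in
/-- The indicator that `S` is open, normalized to have mean `1` under percolation with
parameter `p`. -/
noncomputable def openWeight {α : Type*} (p : ℝ) (S : Finset α) (ω : Set α) : ℝ :=
  if (S : Set α) ⊆ ω then (p ^ S.card)⁻¹ else 0

theorem openWeight_nonneg {α : Type*} {p : ℝ} (hp : 0 ≤ p) (S : Finset α) (ω : Set α) :
    0 ≤ openWeight p S ω := by
  unfold openWeight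
  split_ifs <;> positivity

theorem openWeight_eq_indicator {α : Type*} (p : ℝ) (S : Finset α) :
    openWeight p S = Set.indicator {ω : Set α | (S : Set α) ⊆ ω} (fun _ => (p ^ S.card)⁻¹) := by
  ext ω
  simp [openWeight, Set.indicator]

theorem integrable_openWeight {α : Type*} {u : Set α} (p : unitInterval) (S : Finset α) :
    Integrable (openWeight (p : ℝ) S) (setBernoulli u p) := by
  rw [openWeight_eq_indicator]
  exact (integrable_const _).indicator (measurableSet_subset_config S)

theorem integral_openWeight {α : Type*} {u : Set α} {p : unitInterval} (hp : 0 < (p : ℝ))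
    {S : Finset α} (hS : (S : Set α) ⊆ u) :
    ∫ ω, openWeight (p : ℝ) S ω ∂(setBernoulli u p) = 1 := by
  rw [openWeight_eq_indicator, integral_indicator_const _ (measurableSet_subset_config S),
    setBernoulli_superset p S hS, smul_eq_mul, mul_inv_cancel₀ (pow_pos hp _).ne']

theorem openWeight_mul {α : Type*} [DecidableEq α] (p : ℝ) (S S' : Finset α) :
    (fun ω => openWeight p S ω * openWeight p S' ω)
      = fun ω => (p ^ (S ∩ S').card)⁻¹ * openWeight p (S ∪ S') ω := by
  ext ω
  by_cases h : (S : Set α) ⊆ ω <;> by_cases h' : (S' : Set α) ⊆ ω <;>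
    simp only [openWeight, Finset.coe_union, Set.union_subset_iff, h, h', if_true, if_false,
      and_true, and_false, mul_zero, zero_mul]
  rw [← mul_inv, ← mul_inv, ← pow_add, ← pow_add, Finset.card_inter_add_card_union]

theorem integrable_openWeight_mul {α : Type*} {u : Set α} (p : unitInterval)
    (S S' : Finset α) :
    Integrable (fun ω => openWeight (p : ℝ) S ω * openWeight (p : ℝ) S' ω) (setBernoulli u p) := by
  classical
  rw [openWeight_mul]
  exact (integrable_openWeight p _).const_mul _

theorem integral_openWeight_mul {α : Type*} [DecidableEq α] {u : Set α} {p : unitInterval}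
    (hp : 0 < (p : ℝ)) {S S' : Finset α} (hS : (S : Set α) ⊆ u) (hS' : (S' : Set α) ⊆ u) :
    ∫ ω, openWeight (p : ℝ) S ω * openWeight (p : ℝ) S' ω ∂(setBernoulli u p)
      = ((p : ℝ) ^ (S ∩ S').card)⁻¹ := by
  rw [openWeight_mul, integral_const_mul, integral_openWeight hp, mul_one]
  rw [Finset.coe_union]
  exact Set.union_subset hS hS'

/-- For a law `w` on the subsets of `B`, the normalized `w`-measure of the open subsets. -/
noncomputable def openMass {α : Type*} (p : ℝ) (B : Finset α) (w : Finset α → ℝ) (ω : Set α) : ℝ :=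
  ∑ S ∈ B.powerset, w S * openWeight p S ω

open Classical in
/-- For a law `w` on the subsets of `B`, the normalized `w`-measure of the open subsets that
contain `a`. -/
noncomputable def openMassAt {α : Type*} (p : ℝ) (B : Finset α) (w : Finset α → ℝ) (a : α)
    (ω : Set α) : ℝ :=
  ∑ S ∈ B.powerset with a ∈ S, w S * openWeight p S ω

theorem openMassAt_nonneg {α : Type*} {p : ℝ} (hp : 0 ≤ p) (B : Finset α) {w : Finset α → ℝ}
    (hw : ∀ S, 0 ≤ w S) (a : α) (ω : Set α) : 0 ≤ openMassAt p B w a ω :=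
  Finset.sum_nonneg fun S _ => mul_nonneg (hw S) (openWeight_nonneg hp S ω)

theorem openMassAt_mono {α : Type*} {p : ℝ} (hp : 0 ≤ p) (B : Finset α) {w w' : Finset α → ℝ}
    (hw : ∀ S, w S ≤ w' S) (a : α) (ω : Set α) : openMassAt p B w a ω ≤ openMassAt p B w' a ω :=
  Finset.sum_le_sum fun S _ => mul_le_mul_of_nonneg_right (hw S) (openWeight_nonneg hp S ω)

theorem openMass_sq {α : Type*} (p : ℝ) (B : Finset α) (w : Finset α → ℝ) (ω : Set α) :
    openMass p B w ω ^ 2 = ∑ S ∈ B.powerset, ∑ S' ∈ B.powerset,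
      w S * w S' * (openWeight p S ω * openWeight p S' ω) := by
  rw [openMass, sq, Finset.sum_mul_sum]
  exact Finset.sum_congr rfl fun S _ => Finset.sum_congr rfl fun S' _ => by ring

theorem sum_openMassAt_sq {α : Type*} [DecidableEq α] (p : ℝ) (B : Finset α) (w : Finset α → ℝ)
    (ω : Set α) :
    ∑ a ∈ B, openMassAt p B w a ω ^ 2 = ∑ S ∈ B.powerset, ∑ S' ∈ B.powerset,
      w S * w S' * (S ∩ S').card * (openWeight p S ω * openWeight p S' ω) := by
  have h1 : ∀ a, openMassAt p B w a ω ^ 2 = ∑ S ∈ B.powerset, ∑ S' ∈ B.powerset,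
      if a ∈ S ∩ S' then w S * w S' * (openWeight p S ω * openWeight p S' ω) else 0 := by
    intro a
    have : openMassAt p B w a ω
        = ∑ S ∈ B.powerset, if a ∈ S then w S * openWeight p S ω else 0 := by
      rw [openMassAt, Finset.sum_filter]
      congr!
    rw [this, sq, Finset.sum_mul_sum]
    refine Finset.sum_congr rfl fun S _ => Finset.sum_congr rfl fun S' _ => ?_
    by_cases h : a ∈ S <;> by_cases h' : a ∈ S' <;> simp [h, h']
    ring
  simp only [h1]
  rw [Finset.sum_comm]
  refine Finset.sum_congr rfl fun S hS => ?_
  rw [Finset.sum_comm]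
  refine Finset.sum_congr rfl fun S' _ => ?_
  have hsub : B.filter (fun a => a ∈ S ∩ S') = S ∩ S' := by
    ext a
    simp only [Finset.mem_filter, and_iff_right_iff_imp]
    exact fun ha => Finset.mem_powerset.1 hS (Finset.mem_inter.1 ha).1
  rw [← Finset.sum_filter, hsub, Finset.sum_const, nsmul_eq_mul]
  ring

/-- The `w × w`-mean of `|S ∩ S'| p ^ (-|S ∩ S'|)`. It bounds both the variance of the open mass
and the mean of its energy. -/
noncomputable def pairEnergy {α : Type*} [DecidableEq α] (p : ℝ) (B : Finset α)
    (w : Finset α → ℝ) : ℝ :=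
  ∑ S ∈ B.powerset, ∑ S' ∈ B.powerset,
    w S * w S' * ((S ∩ S').card * (p ^ (S ∩ S').card)⁻¹)

theorem inv_pow_sub_one_le {p : ℝ} (hp : 0 < p) (n : ℕ) :
    (p ^ n)⁻¹ - 1 ≤ n * (p ^ n)⁻¹ := by
  rcases Nat.eq_zero_or_pos n with rfl | hn
  · simp
  · have h1 : (1 : ℝ) ≤ n := by exact_mod_cast hn
    have h2 : 0 < (p ^ n)⁻¹ := by positivity
    nlinarith

/-- Second moment bound: with high probability the open mass stays away from `0` and has bounded
energy, provided that the pair energy is small. -/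
theorem setBernoulli_openMass_bad_le {α : Type*} [DecidableEq α] {u : Set α} {p : unitInterval}
    (hp : 0 < (p : ℝ)) {B : Finset α} (hB : (B : Set α) ⊆ u) {w : Finset α → ℝ}
    (hw : ∀ S, 0 ≤ w S) (hw1 : ∑ S ∈ B.powerset, w S = 1) :
    (setBernoulli u p) {ω | ¬ (1 / 2 ≤ openMass (p : ℝ) B w ω ∧
      ∑ a ∈ B, openMassAt (p : ℝ) B w a ω ^ 2 ≤ 1)} ≤ ENNReal.ofReal (5 * pairEnergy (p : ℝ) B w) := by
  set P := setBernoulli u p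
  have hsub : ∀ S ∈ B.powerset, (S : Set α) ⊆ u := fun S hS =>
    (Finset.coe_subset.2 (Finset.mem_powerset.1 hS)).trans hB
  have iZ : Integrable (fun ω => openMass (p : ℝ) B w ω) P :=
    integrable_finsetSum _ fun S _ => (integrable_openWeight p S).const_mul _
  have iZ2 : Integrable (fun ω => openMass (p : ℝ) B w ω ^ 2) P := by
    simp only [openMass_sq]
    exact integrable_finsetSum _ fun S _ => integrable_finsetSum _ fun S' _ =>
      (integrable_openWeight_mul p S S').const_mul _
  have iE : Integrable (fun ω => ∑ a ∈ B, openMassAt (p : ℝ) B w a ω ^ 2) P := by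
    simp only [sum_openMassAt_sq]
    exact integrable_finsetSum _ fun S _ => integrable_finsetSum _ fun S' _ =>
      (integrable_openWeight_mul p S S').const_mul _
  have eZ : ∫ ω, openMass (p : ℝ) B w ω ∂P = 1 := by
    simp only [openMass]
    rw [integral_finsetSum _ fun S _ => (integrable_openWeight p S).const_mul _, ← hw1]
    refine Finset.sum_congr rfl fun S hS => ?_
    rw [integral_const_mul, integral_openWeight hp (hsub S hS), mul_one]
  have eZ2 : ∫ ω, openMass (p : ℝ) B w ω ^ 2 ∂P = ∑ S ∈ B.powerset, ∑ S' ∈ B.powerset,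
      w S * w S' * ((p : ℝ) ^ (S ∩ S').card)⁻¹ := by
    simp only [openMass_sq]
    rw [integral_finsetSum _ fun S _ => integrable_finsetSum _ fun S' _ =>
      (integrable_openWeight_mul p S S').const_mul _]
    refine Finset.sum_congr rfl fun S hS => ?_
    rw [integral_finsetSum _ fun S' _ => (integrable_openWeight_mul p S S').const_mul _]
    refine Finset.sum_congr rfl fun S' hS' => ?_
    rw [integral_const_mul, integral_openWeight_mul hp (hsub S hS) (hsub S' hS')]
  have eE : ∫ ω, ∑ a ∈ B, openMassAt (p : ℝ) B w a ω ^ 2 ∂P = pairEnergy (p : ℝ) B w := by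
    simp only [sum_openMassAt_sq]
    rw [integral_finsetSum _ fun S _ => integrable_finsetSum _ fun S' _ =>
      (integrable_openWeight_mul p S S').const_mul _]
    refine Finset.sum_congr rfl fun S hS => ?_
    rw [integral_finsetSum _ fun S' _ => (integrable_openWeight_mul p S S').const_mul _]
    refine Finset.sum_congr rfl fun S' hS' => ?_
    rw [integral_const_mul, integral_openWeight_mul hp (hsub S hS) (hsub S' hS'), mul_assoc]
  have hvar : ∫ ω, openMass (p : ℝ) B w ω ^ 2 ∂P - 1 ≤ pairEnergy (p : ℝ) B w := by
    have h1 : (1 : ℝ) = ∑ S ∈ B.powerset, ∑ S' ∈ B.powerset, w S * w S' := by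
      rw [← Finset.sum_mul_sum, hw1, one_mul]
    rw [eZ2]
    conv_lhs => rw [h1]
    simp only [← Finset.sum_sub_distrib]
    refine Finset.sum_le_sum fun S _ => Finset.sum_le_sum fun S' _ => ?_
    have := mul_le_mul_of_nonneg_left (inv_pow_sub_one_le hp (S ∩ S').card)
      (mul_nonneg (hw S) (hw S'))
    linarith
  -- Markov's inequality for `4 * (mass - 1) ^ 2 + energy`, which is at least `1` when the mass is
  -- below `1 / 2` or the energy exceeds `1`.
  set Y : Set α → ℝ := fun ω => 4 * (openMass (p : ℝ) B w ω ^ 2 - 2 * openMass (p : ℝ) B w ω + 1)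
    + ∑ a ∈ B, openMassAt (p : ℝ) B w a ω ^ 2 with hY
  have hYnn : ∀ ω, 0 ≤ Y ω := by
    intro ω
    have : 0 ≤ ∑ a ∈ B, openMassAt (p : ℝ) B w a ω ^ 2 := Finset.sum_nonneg fun _ _ => sq_nonneg _
    simp only [hY]
    nlinarith [sq_nonneg (openMass (p : ℝ) B w ω - 1)]
  have iV : Integrable (fun ω => 4 * (openMass (p : ℝ) B w ω ^ 2
      - 2 * openMass (p : ℝ) B w ω + 1)) P :=
    ((iZ2.sub (iZ.const_mul 2)).add (integrable_const 1)).const_mul 4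
  have iY : Integrable Y P := iV.add iE
  have eY : ∫ ω, Y ω ∂P ≤ 5 * pairEnergy (p : ℝ) B w := by
    have i1 : Integrable (fun ω => openMass (p : ℝ) B w ω ^ 2
      - 2 * openMass (p : ℝ) B w ω) P := iZ2.sub (iZ.const_mul 2)
    simp only [hY]
    rw [integral_add iV iE, integral_const_mul, integral_add i1 (integrable_const 1),
      integral_sub iZ2 (iZ.const_mul 2), integral_const_mul, eZ, eE]
    simp only [integral_const, probReal_univ, smul_eq_mul, mul_one]
    linarith
  have hmarkov := mul_meas_ge_le_integral_of_nonneg (ae_of_all P hYnn) iY 1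
  rw [one_mul] at hmarkov
  calc P {ω | ¬ (1 / 2 ≤ openMass (p : ℝ) B w ω ∧
        ∑ a ∈ B, openMassAt (p : ℝ) B w a ω ^ 2 ≤ 1)} ≤ P {ω | 1 ≤ Y ω} := by
        refine measure_mono fun ω hω => ?_
        simp only [Set.mem_ofPred_eq, not_and_or, not_le] at hω ⊢
        have : 0 ≤ ∑ a ∈ B, openMassAt (p : ℝ) B w a ω ^ 2 :=
          Finset.sum_nonneg fun _ _ => sq_nonneg _
        simp only [hY]
        rcases hω with h | h
        · nlinarith
        · nlinarith [sq_nonneg (openMass (p : ℝ) B w ω - 1)]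
    _ = ENNReal.ofReal (P.real {ω | 1 ≤ Y ω}) := (ofReal_measureReal (measure_ne_top _ _)).symm
    _ ≤ _ := ENNReal.ofReal_le_ofReal (hmarkov.trans eY)

/-- A lower bound `c` for the `m`-weight of the open sets charged by `w` gives a lower bound for
the sum of the squares of `m`, by the Cauchy–Schwarz inequality. -/
theorem sq_mul_openMass_le {α : Type*} {p : ℝ} (hp : 0 ≤ p) (B : Finset α) {w : Finset α → ℝ}
    (hw : ∀ S, 0 ≤ w S) (ω : Set α) (m : α → ℝ) {c : ℝ} (hc : 0 ≤ c)
    (h : ∀ S ⊆ B, w S ≠ 0 → (S : Set α) ⊆ ω → c ≤ ∑ a ∈ S, m a) :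
    (c * openMass p B w ω) ^ 2 ≤ (∑ a ∈ B, m a ^ 2) * ∑ a ∈ B, openMassAt p B w a ω ^ 2 := by
  classical
  have hle : c * openMass p B w ω ≤ ∑ a ∈ B, m a * openMassAt p B w a ω := by
    calc c * openMass p B w ω = ∑ S ∈ B.powerset, c * (w S * openWeight p S ω) := by
          rw [openMass, Finset.mul_sum]
      _ ≤ ∑ S ∈ B.powerset, ∑ a ∈ S, m a * (w S * openWeight p S ω) := by
          refine Finset.sum_le_sum fun S hS => ?_
          rw [← Finset.sum_mul]
          by_cases h0 : w S = 0
          · simp [h0]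
          by_cases h1 : (S : Set α) ⊆ ω
          · exact mul_le_mul_of_nonneg_right (h S (Finset.mem_powerset.1 hS) h0 h1)
              (mul_nonneg (hw S) (openWeight_nonneg hp S ω))
          · simp [openWeight, h1]
      _ = ∑ a ∈ B, ∑ S ∈ B.powerset with a ∈ S, m a * (w S * openWeight p S ω) := by
          refine Finset.sum_comm' fun S a => ?_
          simp only [Finset.mem_powerset, Finset.mem_filter]
          exact ⟨fun h => ⟨h, h.1 h.2⟩, fun h => h.1⟩
      _ = _ := by
          refine Finset.sum_congr rfl fun a _ => ?_
          rw [openMassAt, Finset.mul_sum]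
  have h0 : 0 ≤ c * openMass p B w ω :=
    mul_nonneg hc (Finset.sum_nonneg fun S _ => mul_nonneg (hw S) (openWeight_nonneg hp S ω))
  exact (pow_le_pow_left₀ h0 hle 2).trans (Finset.sum_mul_sq_le_sq_mul_sq _ _ _)

/-! ### Intersections of two independent paths -/

theorem pairEnergy_le_tsum {α Ω : Type*} [DecidableEq α] [MeasurableSpace Ω] (μ : Measure Ω)
    [IsProbabilityMeasure μ] {p : ℝ} (hp : 0 < p) (B : Finset α) (τ : Ω → Finset α)
    (hτ : ∀ S, MeasurableSet {x | τ x = S}) (a : ℕ → ℝ)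
    (ha : ∀ n, (μ.prod μ).real {q | n ≤ (τ q.1 ∩ τ q.2).card} ≤ a n)
    (hsum : Summable fun n : ℕ => n * (p ^ n)⁻¹ * a n) :
    pairEnergy p B (fun S => μ.real {x | τ x = S}) ≤ ∑' n : ℕ, n * (p ^ n)⁻¹ * a n := by
  have ha0 : ∀ n, 0 ≤ a n := fun n => measureReal_nonneg.trans (ha n)
  set Q := B.powerset ×ˢ B.powerset
  let R : Finset α × Finset α → Set (Ω × Ω) := fun s => {x | τ x = s.1} ×ˢ {x | τ x = s.2}
  calc pairEnergy p B (fun S => μ.real {x | τ x = S})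
      = ∑ s ∈ Q, (s.1 ∩ s.2).card * (p ^ (s.1 ∩ s.2).card)⁻¹ * (μ.prod μ).real (R s) := by
        rw [pairEnergy, ← Finset.sum_product']
        refine Finset.sum_congr rfl fun s _ => ?_
        rw [measureReal_prod_prod]
        ring
    _ = ∑ n ∈ Finset.range (B.card + 1), ∑ s ∈ Q with (s.1 ∩ s.2).card = n,
          (s.1 ∩ s.2).card * (p ^ (s.1 ∩ s.2).card)⁻¹ * (μ.prod μ).real (R s) := by
        refine (Finset.sum_fiberwise_of_maps_to (fun s hs => ?_) _).symm
        rw [Finset.mem_range, Nat.lt_succ_iff]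
        exact Finset.card_le_card
          (Finset.inter_subset_left.trans (Finset.mem_powerset.1 (Finset.mem_product.1 hs).1))
    _ ≤ ∑ n ∈ Finset.range (B.card + 1), n * (p ^ n)⁻¹ * a n := by
        refine Finset.sum_le_sum fun n _ => ?_
        have hcongr : ∑ s ∈ Q with (s.1 ∩ s.2).card = n,
            (s.1 ∩ s.2).card * (p ^ (s.1 ∩ s.2).card)⁻¹ * (μ.prod μ).real (R s)
            = n * (p ^ n)⁻¹ * ∑ s ∈ Q with (s.1 ∩ s.2).card = n, (μ.prod μ).real (R s) := by
          rw [Finset.mul_sum]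
          refine Finset.sum_congr rfl fun s hs => ?_
          rw [(Finset.mem_filter.1 hs).2]
        rw [hcongr]
        refine mul_le_mul_of_nonneg_left ?_ (by positivity)
        rw [← measureReal_biUnion_finset]
        · refine (measureReal_mono ?_).trans (ha n)
          intro q hq
          simp only [Set.mem_iUnion] at hq
          obtain ⟨s, hs, hq1, hq2⟩ := hq
          simp only [Set.mem_ofPred_eq] at hq1 hq2 ⊢
          rw [hq1, hq2, (Finset.mem_filter.1 hs).2]
        · intro s _ s' _ hne
          refine Set.disjoint_left.2 fun q hq hq' => hne ?_
          exact Prod.ext (hq.1.symm.trans hq'.1) (hq.2.symm.trans hq'.2)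
        · exact fun s _ => (hτ _).prod (hτ _)
    _ ≤ _ := hsum.sum_le_tsum _ fun n _ => mul_nonneg (by positivity) (ha0 n)

/-- The labels `t (φ n) (φ (n + 1))` of the arcs that the path `φ` uses from time `k` on. -/
def tailLabels {α : Type*} (t : V → V → α) (k : ℕ) (φ : ℕ → V) : Set α :=
  {a | ∃ n, k ≤ n ∧ t (φ n) (φ (n + 1)) = a}

theorem tailLabels_anti {α : Type*} (t : V → V → α) (φ : ℕ → V) {k l : ℕ} (h : k ≤ l) :
    tailLabels t l φ ⊆ tailLabels t k φ :=
  fun _ ⟨n, hn, he⟩ => ⟨n, h.trans hn, he⟩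

/-- The vertices that a directed path from `v₀` can reach within `n` steps. -/
def outBall (G : Digraph V) (v₀ : V) : ℕ → Set V
  | 0 => {v₀}
  | n + 1 => outBall G v₀ n ∪ {y | ∃ x ∈ outBall G v₀ n, G.Adj x y}

theorem outBall_mono (G : Digraph V) (v₀ : V) : Monotone (outBall G v₀) :=
  monotone_nat_of_le_succ fun _ => Set.subset_union_left

theorem outBall_finite {G : Digraph V} (hG : LocFinite G) (v₀ : V) (n : ℕ) :
    (outBall G v₀ n).Finite := by
  induction n with
  | zero => exact Set.finite_singleton v₀
  | succ n ih =>
    refine ih.union ((ih.biUnion fun x _ => (hG x).1).subset ?_)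
    rintro y ⟨x, hx, hxy⟩
    exact Set.mem_biUnion hx hxy

theorem PathsToInfinity.mem_outBall {G : Digraph V} {v₀ : V} (φ : PathsToInfinity G v₀) (n : ℕ) :
    φ.1 n ∈ outBall G v₀ n := by
  induction n with
  | zero => exact φ.2.1
  | succ n ih => exact Or.inr ⟨_, ih, φ.2.2.1 n⟩

/-- The labels of the arcs of `G` whose tail can be reached from `v₀` within `n` steps. -/
noncomputable def ballLabels {α : Type*} {G : Digraph V} (hG : LocFinite G) (v₀ : V)
    (t : V → V → α) (n : ℕ) : Finset α :=
  (((outBall_finite hG v₀ n).biUnion fun x _ => (hG x).1.image (t x)).toFinset :)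

theorem mem_ballLabels {α : Type*} {G : Digraph V} {hG : LocFinite G} {v₀ : V}
    {t : V → V → α} {n : ℕ} {a : α} :
    a ∈ ballLabels hG v₀ t n ↔ ∃ x ∈ outBall G v₀ n, ∃ y, G.Adj x y ∧ t x y = a := by
  simp [ballLabels]

theorem measurableSet_coord {G : Digraph V} {v₀ : V} (n : ℕ) (x : V) :
    MeasurableSet {φ : PathsToInfinity G v₀ | φ.1 n = x} :=
  (le_iSup (fun n : ℕ => MeasurableSpace.comap
    (fun φ : PathsToInfinity G v₀ => φ.1 n) ⊤) n) _ ⟨{x}, trivial, rfl⟩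

theorem measurableSet_mem_tailLabels {α : Type*} {G : Digraph V} (hG : LocFinite G) {v₀ : V}
    (t : V → V → α) (k : ℕ) (a : α) :
    MeasurableSet {φ : PathsToInfinity G v₀ | a ∈ tailLabels t k φ.1} := by
  -- `V` may be uncountable, so the measurability of the pair of two coordinates needs the
  -- finiteness of the balls.
  have : {φ : PathsToInfinity G v₀ | a ∈ tailLabels t k φ.1} = ⋃ n, ⋃ (_ : k ≤ n),
      ⋃ x ∈ outBall G v₀ n, ⋃ y ∈ outBall G v₀ (n + 1), ⋃ (_ : t x y = a),
        {φ : PathsToInfinity G v₀ | φ.1 n = x} ∩ {φ | φ.1 (n + 1) = y} := by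
    ext φ
    simp only [Set.mem_ofPred_eq, Set.mem_iUnion, Set.mem_inter_iff, exists_prop]
    constructor
    · rintro ⟨n, hn, he⟩
      exact ⟨n, hn, _, φ.mem_outBall n, _, φ.mem_outBall (n + 1), he, rfl, rfl⟩
    · rintro ⟨n, hn, x, -, y, -, he, rfl, rfl⟩
      exact ⟨n, hn, he⟩
  rw [this]
  refine .iUnion fun n => .iUnion fun _ => (outBall_finite hG v₀ n).measurableSet_biUnion fun x _ =>
    (outBall_finite hG v₀ (n + 1)).measurableSet_biUnion fun y _ => .iUnion fun _ => ?_
  exact (measurableSet_coord n x).inter (measurableSet_coord (n + 1) y)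

/-- A path that tends to infinity uses each label finitely often. -/
theorem exists_notMem_tailLabels {α : Type*} {t : V → V → α}
    (ht : ∀ a b c d, t a b = t c d → a = c ∨ a = d) {G : Digraph V} {v₀ : V}
    (φ : PathsToInfinity G v₀) (a : α) : ∃ k, a ∉ tailLabels t k φ.1 := by
  by_cases h : ∃ n, t (φ.1 n) (φ.1 (n + 1)) = a
  · obtain ⟨n, rfl⟩ := h
    obtain ⟨M, hM⟩ := ((φ.2.2.2 (φ.1 n)).union (φ.2.2.2 (φ.1 (n + 1)))).bddAbove
    refine ⟨M + 1, ?_⟩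
    rintro ⟨j, hj, he⟩
    have := hM (a := j) (ht _ _ _ _ he)
    omega
  · push Not at h
    exact ⟨0, fun ⟨n, _, hn⟩ => h n hn⟩

/-- The probability that two independent paths share at least `n` labels after time `k`. -/
noncomputable def tailMeet {α : Type*} (t : V → V → α) {G : Digraph V} {v₀ : V}
    (μ : Measure (PathsToInfinity G v₀)) (k n : ℕ) : ℝ :=
  (μ.prod μ).real {q | (n : ℕ∞) ≤ (tailLabels t k q.1.1 ∩ tailLabels t k q.2.1).encard}

theorem tailMeet_le {α : Type*} {t : V → V → α} {G : Digraph V} {v₀ : V}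
    {μ : Measure (PathsToInfinity G v₀)} [IsProbabilityMeasure μ] {θ C : ℝ} (hθ : 0 < θ)
    (hC : ∀ n : ℕ, (μ.prod μ) {q | (n : ℕ∞) ≤
      ((Set.range fun j => t (q.1.1 j) (q.1.1 (j + 1))) ∩
        Set.range fun j => t (q.2.1 j) (q.2.1 (j + 1))).encard} ≤ ENNReal.ofReal (C * θ ^ n))
    (k n : ℕ) : tailMeet t μ k n ≤ |C| * θ ^ n := by
  have hsub : ∀ φ : ℕ → V, tailLabels t k φ ⊆ Set.range fun j => t (φ j) (φ (j + 1)) :=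
    fun φ _ ⟨j, _, hj⟩ => ⟨j, hj⟩
  refine ENNReal.toReal_le_of_le_ofReal (by positivity) ?_
  refine (measure_mono fun q hq => ?_).trans ((hC n).trans (ENNReal.ofReal_le_ofReal
    (mul_le_mul_of_nonneg_right (le_abs_self C) (by positivity))))
  exact le_trans (α := ℕ∞) hq (Set.encard_le_encard (Set.inter_subset_inter (hsub _) (hsub _)))

theorem tendsto_tailMeet {α : Type*} {t : V → V → α}
    (ht : ∀ a b c d, t a b = t c d → a = c ∨ a = d) {G : Digraph V} (hG : LocFinite G) {v₀ : V}
    {μ : Measure (PathsToInfinity G v₀)} [IsProbabilityMeasure μ] {θ C : ℝ} (hθ : 0 < θ)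
    (hθ1 : θ < 1) (hC : ∀ n, tailMeet t μ 0 n ≤ C * θ ^ n) {n : ℕ} (hn : 1 ≤ n) :
    Tendsto (fun k => tailMeet t μ k n) atTop (𝓝 0) := by
  let P := PathsToInfinity G v₀
  let A : ℕ → Set (P × P) := fun k => {q | (tailLabels t k q.1.1 ∩ tailLabels t k q.2.1).Nonempty}
  have hAm : ∀ k, MeasurableSet (A k) := by
    intro k
    have : A k = ⋃ N, ⋃ a ∈ ballLabels hG v₀ t N,
        {φ : P | a ∈ tailLabels t k φ.1} ×ˢ {φ : P | a ∈ tailLabels t k φ.1} := by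
      ext q
      simp only [A, Set.mem_ofPred_eq, Set.mem_iUnion, Set.mem_prod, exists_prop]
      constructor
      · rintro ⟨a, ⟨j, hj, hja⟩, h2⟩
        exact ⟨j, a, mem_ballLabels.2 ⟨_, q.1.mem_outBall j, _, q.1.2.2.1 j, hja⟩, ⟨j, hj, hja⟩, h2⟩
      · rintro ⟨_, a, _, h1, h2⟩
        exact ⟨a, h1, h2⟩
    rw [this]
    exact .iUnion fun N => Finset.measurableSet_biUnion _ fun a _ =>
      (measurableSet_mem_tailLabels hG t k a).prod (measurableSet_mem_tailLabels hG t k a)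
  have hAanti : Antitone A := fun k l hkl q hq =>
    hq.mono (Set.inter_subset_inter (tailLabels_anti t _ hkl) (tailLabels_anti t _ hkl))
  -- Two paths that meet after any time have infinitely many common labels.
  have hinf : ∀ m : ℕ, ⋂ k, A k ⊆
      {q | (m : ℕ∞) ≤ (tailLabels t 0 q.1.1 ∩ tailLabels t 0 q.2.1).encard} := by
    intro m q hq
    have : (tailLabels t 0 q.1.1 ∩ tailLabels t 0 q.2.1).Infinite := by
      intro hfin
      choose κ hκ using fun a => exists_notMem_tailLabels ht q.1 a
      obtain ⟨a, ha1, ha2⟩ := Set.mem_iInter.1 hq (hfin.toFinset.sup κ)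
      have ha : a ∈ hfin.toFinset := hfin.mem_toFinset.2
        ⟨tailLabels_anti t _ (Nat.zero_le _) ha1, tailLabels_anti t _ (Nat.zero_le _) ha2⟩
      exact hκ a (tailLabels_anti t _ (Finset.le_sup ha) ha1)
    simp [this.encard_eq]
  have hnull : (μ.prod μ) (⋂ k, A k) = 0 := by
    rw [← measureReal_eq_zero_iff]
    refine le_antisymm ?_ measureReal_nonneg
    refine ge_of_tendsto' (f := fun m : ℕ => C * θ ^ m) (x := atTop) ?_ fun m =>
      (measureReal_mono (hinf m)).trans (hC m)
    simpa using (tendsto_pow_atTop_nhds_zero_of_lt_one hθ.le hθ1).const_mul C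
  have hlim : Tendsto (fun k => (μ.prod μ).real (A k)) atTop (𝓝 0) := by
    have := tendsto_measure_iInter_atTop (μ := μ.prod μ) (fun k => (hAm k).nullMeasurableSet)
      hAanti ⟨0, measure_ne_top _ _⟩
    rw [hnull] at this
    exact (ENNReal.tendsto_toReal ENNReal.zero_ne_top).comp this
  refine squeeze_zero (fun _ => measureReal_nonneg) (fun k => measureReal_mono fun q hq => ?_) hlim
  rw [Set.mem_ofPred_eq] at hq
  rw [Set.mem_ofPred_eq, ← Set.one_le_encard_iff_nonempty]
  exact le_trans (by exact_mod_cast hn) hq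

theorem summable_mul_inv_pow_mul {θ p : ℝ} (hθ : 0 < θ) (hp : θ < p) (C : ℝ) :
    Summable fun n : ℕ => n * (p ^ n)⁻¹ * (C * θ ^ n) := by
  have hp0 : 0 < p := hθ.trans hp
  have h := (summable_pow_mul_geometric_of_norm_lt_one 1 (r := θ / p) (by
    rw [Real.norm_of_nonneg (by positivity), div_lt_one hp0]; exact hp)).mul_left C
  refine h.congr fun n => ?_
  rw [div_pow, pow_one]
  field_simp

/-- The pair energy of the tails of the paths is finite and vanishes in the limit. -/
theorem tendsto_tsum_tailMeet {α : Type*} {t : V → V → α}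
    (ht : ∀ a b c d, t a b = t c d → a = c ∨ a = d) {G : Digraph V} (hG : LocFinite G) {v₀ : V}
    {μ : Measure (PathsToInfinity G v₀)} [IsProbabilityMeasure μ] {θ p C : ℝ} (hθ : 0 < θ)
    (hθ1 : θ < 1) (hp : θ < p) (hC : ∀ k n, tailMeet t μ k n ≤ C * θ ^ n) :
    Tendsto (fun k => ∑' n : ℕ, n * (p ^ n)⁻¹ * tailMeet t μ k n) atTop (𝓝 0) := by
  have hp0 : 0 < p := hθ.trans hp
  have h := tendsto_tsum_of_dominated_convergence (𝓕 := atTop)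
    (f := fun k (n : ℕ) => n * (p ^ n)⁻¹ * tailMeet t μ k n) (g := fun _ => 0)
    (summable_mul_inv_pow_mul hθ hp C) ?_ (.of_forall fun k n => ?_)
  · simpa using h
  · intro n
    rcases Nat.eq_zero_or_pos n with rfl | hn
    · simp
    · simpa using (tendsto_tailMeet ht hG hθ hθ1 (hC 0) hn).const_mul ((n : ℝ) * (p ^ n)⁻¹)
  · have h0 : 0 ≤ tailMeet t μ k n := measureReal_nonneg
    rw [Real.norm_of_nonneg (by positivity)]
    exact mul_le_mul_of_nonneg_left (hC k n) (by positivity)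

/-! ### Transient open clusters -/

/-- The length of the gradient of `g` over the arcs labelled `a` that start in `F`. -/
noncomputable def labelGradient {α : Type*} [DecidableEq α] (H : Subdigraph V)
    (hfin : ∀ x, (H.neighbors x).Finite) (t : V → V → α) (F : Finset V) (g : V → ℝ) (a : α) : ℝ :=
  √(∑ e ∈ (F.sigma fun x => (hfin x).toFinset) with t e.1 e.2 = a, (g e.1 - g e.2) ^ 2)

theorem sum_labelGradient_sq_le {α : Type*} [DecidableEq α] (H : Subdigraph V)
    (hfin : ∀ x, (H.neighbors x).Finite) (t : V → V → α) (F : Finset V) (g : V → ℝ)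
    (B : Finset α) : ∑ a ∈ B, labelGradient H hfin t F g a ^ 2 ≤ H.energy hfin F g := by
  have : ∀ a, labelGradient H hfin t F g a ^ 2
      = ∑ e ∈ (F.sigma fun x => (hfin x).toFinset) with t e.1 e.2 = a, (g e.1 - g e.2) ^ 2 :=
    fun a => Real.sq_sqrt (Finset.sum_nonneg fun _ _ => sq_nonneg _)
  simp only [this, Subdigraph.energy]
  rw [← Finset.sum_sigma (s := F) (t := fun x => (hfin x).toFinset)
    (f := fun e => (g e.1 - g e.2) ^ 2)]
  exact Finset.sum_fiberwise_le_sum_of_sum_fiber_nonneg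
    fun a _ => Finset.sum_nonneg fun _ _ => sq_nonneg _

theorem abs_sub_le_labelGradient {α : Type*} [DecidableEq α] (H : Subdigraph V)
    (hfin : ∀ x, (H.neighbors x).Finite) (t : V → V → α) {F : Finset V} (g : V → ℝ) {x y : V}
    (hx : x ∈ F) (hxy : H.Adj x y) : |g x - g y| ≤ labelGradient H hfin t F g (t x y) := by
  refine Real.abs_le_sqrt ?_
  refine Finset.single_le_sum
    (f := fun e : (Σ _ : V, V) => (g e.1 - g e.2) ^ 2) (fun _ _ => sq_nonneg _)
    (a := ⟨x, y⟩) ?_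
  rw [Finset.mem_filter, Finset.mem_sigma]
  exact ⟨⟨hx, (hfin x).mem_toFinset.2 (Or.inl hxy)⟩, rfl⟩

/-- If a path to infinity from `v` is open until it leaves the support `F` of `g`, then this part
of the path lies in the cluster of `v`, and the gradient of `g` along it sums to at least
`|g v|`. -/
theorem abs_le_sum_labelGradient {α : Type*} [DecidableEq α] {t : V → V → α}
    (ht : ∀ a b c d, t a b = t c d → a = c ∨ a = d) {G D : Digraph V} {ω : Set α}
    (hD : ∀ a b c, G.Adj a b → G.Adj b c → t a b ∈ ω → t b c ∈ ω → D.Adj a b)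
    {v : V} (hfin : ∀ x, ((cluster D v).neighbors x).Finite) {F : Finset V} {g : V → ℝ}
    (hg : ∀ x ∉ F, g x = 0) {φ : ℕ → V} (hφ0 : φ 0 = v) (hφ : ∀ n, G.Adj (φ n) (φ (n + 1)))
    (hφinf : ∀ x, {n | φ n = x}.Finite) {S : Finset α} (hSω : (S : Set α) ⊆ ω)
    (hS : ∀ j, φ j ∈ F → t (φ j) (φ (j + 1)) ∈ S ∧ t (φ (j + 1)) (φ (j + 2)) ∈ S) :
    |g v| ≤ ∑ a ∈ S, labelGradient (cluster D v) hfin t F g a := by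
  classical
  have hexit : ∃ j, φ j ∉ F := by
    have hF : {j | φ j ∈ F}.Finite := by
      have : {j | φ j ∈ F} = ⋃ x ∈ F, {j | φ j = x} := by ext; simp
      rw [this]
      exact F.finite_toSet.biUnion fun x _ => hφinf x
    exact hF.exists_notMem
  set T := Nat.find hexit
  have hin : ∀ j < T, φ j ∈ F := fun j hj => not_not.1 (Nat.find_min hexit hj)
  have hadj : ∀ j < T, D.Adj (φ j) (φ (j + 1)) := fun j hj =>
    hD _ _ _ (hφ j) (hφ (j + 1)) (hSω (hS j (hin j hj)).1) (hSω (hS j (hin j hj)).2)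
  have hreach : ∀ j ≤ T, Relation.ReflTransGen D.Adj v (φ j) := by
    intro j
    induction j with
    | zero => intro _; rw [hφ0]
    | succ j ih => exact fun hj => (ih (by omega)).tail (hadj j (by omega))
  have h := abs_sub_le_sum_labels ht g (labelGradient (cluster D v) hfin t F g)
    (fun _ => Real.sqrt_nonneg _) T φ fun j hj =>
      abs_sub_le_labelGradient _ hfin t g (hin j hj) ⟨hreach j hj.le, hadj j hj⟩
  rw [hg _ (Nat.find_spec hexit), sub_zero, hφ0] at h
  refine h.trans (Finset.sum_le_sum_of_subset_of_nonneg ?_ fun _ _ _ => Real.sqrt_nonneg _)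
  intro a ha
  simp only [Finset.mem_image, Finset.mem_range] at ha
  obtain ⟨j, hj, rfl⟩ := ha
  exact (hS j (hin j hj)).1

/-- The labels in the ball of radius `N` that the path `φ` uses from time `k` on. -/
noncomputable def ballTrace {α : Type*} {G : Digraph V} (hG : LocFinite G) {v₀ : V}
    (t : V → V → α) (k N : ℕ) (φ : PathsToInfinity G v₀) : Finset α :=
  open Classical in (ballLabels hG v₀ t N).filter (· ∈ tailLabels t k φ.1)

theorem measurableSet_ballTrace {α : Type*} {G : Digraph V} (hG : LocFinite G) {v₀ : V}
    (t : V → V → α) (k N : ℕ) (S : Finset α) :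
    MeasurableSet {φ : PathsToInfinity G v₀ | ballTrace hG t k N φ = S} := by
  classical
  have : {φ : PathsToInfinity G v₀ | ballTrace hG t k N φ = S}
      = {_φ | S ⊆ ballLabels hG v₀ t N} ∩ ⋂ a ∈ ballLabels hG v₀ t N,
        {φ | a ∈ tailLabels t k φ.1 ↔ a ∈ S} := by
    ext φ
    simp only [ballTrace, Set.mem_ofPred_eq, Set.mem_inter_iff, Set.mem_iInter, Finset.ext_iff,
      Finset.mem_filter, Finset.subset_iff]
    constructor
    · intro h
      exact ⟨fun a ha => ((h a).2 ha).1, fun a ha => ⟨fun h' => (h a).1 ⟨ha, h'⟩,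
        fun h' => ((h a).2 h').2⟩⟩
    · rintro ⟨h1, h2⟩ a
      exact ⟨fun h => (h2 a h.1).1 h.2, fun h => ⟨h1 h, (h2 a (h1 h)).2 h⟩⟩
  rw [this]
  refine (MeasurableSet.const _).inter (Finset.measurableSet_biInter _ fun a _ => ?_)
  by_cases ha : a ∈ S
  · simpa [ha] using measurableSet_mem_tailLabels hG t k a
  · simp only [ha, iff_false]
    exact (measurableSet_mem_tailLabels hG t k a).compl

/-- The law of `ballTrace`. -/
noncomputable def traceLaw {α : Type*} {G : Digraph V} (hG : LocFinite G) {v₀ : V}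
    (μ : Measure (PathsToInfinity G v₀)) (t : V → V → α) (k N : ℕ) (S : Finset α) : ℝ :=
  μ.real {φ | ballTrace hG t k N φ = S}

/-- The law of `ballTrace`, restricted to the paths that are at `v` at time `k`. -/
noncomputable def traceLawAt {α : Type*} {G : Digraph V} (hG : LocFinite G) {v₀ : V}
    (μ : Measure (PathsToInfinity G v₀)) (t : V → V → α) (k N : ℕ) (v : V) (S : Finset α) : ℝ :=
  μ.real {φ | φ.1 k = v ∧ ballTrace hG t k N φ = S}

section Law

variable {α : Type*} {G : Digraph V} (hG : LocFinite G) {v₀ : V}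
  (μ : Measure (PathsToInfinity G v₀)) [IsProbabilityMeasure μ] (t : V → V → α) (k N : ℕ)

theorem traceLawAt_le (v : V) (S : Finset α) :
    traceLawAt hG μ t k N v S ≤ traceLaw hG μ t k N S :=
  measureReal_mono fun _ h => h.2

theorem sum_traceLaw : ∑ S ∈ (ballLabels hG v₀ t N).powerset, traceLaw hG μ t k N S = 1 := by
  classical
  rw [← probReal_univ (μ := μ)]
  simp only [traceLaw]
  rw [← measureReal_biUnion_finset]
  · congr 1
    ext φ
    simp only [Set.mem_iUnion, Set.mem_univ, iff_true]
    exact ⟨_, Finset.mem_powerset.2 (Finset.filter_subset _ _), rfl⟩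
  · intro S _ S' _ hne
    exact Set.disjoint_left.2 fun φ h h' => hne (h.symm.trans h')
  · exact fun S _ => measurableSet_ballTrace hG t k N S

theorem sum_traceLawAt (S : Finset α) :
    ∑ v ∈ (outBall_finite hG v₀ k).toFinset, traceLawAt hG μ t k N v S = traceLaw hG μ t k N S := by
  classical
  simp only [traceLaw, traceLawAt]
  rw [← measureReal_biUnion_finset]
  · congr 1
    ext φ
    simp only [Set.mem_iUnion, Set.mem_ofPred_eq, exists_prop]
    constructor
    · rintro ⟨_, _, _, h⟩
      exact h
    · exact fun h => ⟨_, (outBall_finite hG v₀ k).mem_toFinset.2 (φ.mem_outBall k), rfl, h⟩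
  · intro v _ v' _ hne
    exact Set.disjoint_left.2 fun φ h h' => hne (h.1.symm.trans h'.1)
  · exact fun v _ => (measurableSet_coord k v).inter (measurableSet_ballTrace hG t k N S)

theorem sum_openMass_traceLawAt (p : ℝ) (ω : Set α) :
    ∑ v ∈ (outBall_finite hG v₀ k).toFinset,
      openMass p (ballLabels hG v₀ t N) (traceLawAt hG μ t k N v) ω
      = openMass p (ballLabels hG v₀ t N) (traceLaw hG μ t k N) ω := by
  simp only [openMass]
  rw [Finset.sum_comm]
  refine Finset.sum_congr rfl fun S _ => ?_
  rw [← Finset.sum_mul, sum_traceLawAt]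

end Law

/-- If, in arbitrarily large balls, the open paths after time `k` have mass bounded below and
energy bounded above, then one of the finitely many vertices that can be reached in `k` steps has
a transient cluster. -/
theorem exists_transient_of_frequently {α : Type*} {t : V → V → α}
    (ht : ∀ a b c d, t a b = t c d → a = c ∨ a = d) {G D : Digraph V} (hG : LocFinite G)
    {ω : Set α} (hDG : ∀ a b, D.Adj a b → G.Adj a b)
    (hD : ∀ a b c, G.Adj a b → G.Adj b c → t a b ∈ ω → t b c ∈ ω → D.Adj a b) {v₀ : V}
    (μ : Measure (PathsToInfinity G v₀)) [IsProbabilityMeasure μ] {p : ℝ} (hp : 0 ≤ p) (k : ℕ)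
    (hω : ∃ᶠ N in atTop, 1 / 2 ≤ openMass p (ballLabels hG v₀ t N) (traceLaw hG μ t k N) ω ∧
      ∑ a ∈ ballLabels hG v₀ t N,
        openMassAt p (ballLabels hG v₀ t N) (traceLaw hG μ t k N) a ω ^ 2 ≤ 1) :
    ∃ v b, G.Adj v b ∧ t v b ∈ ω ∧ (cluster D v).Transient := by
  classical
  set R := (outBall_finite hG v₀ k).toFinset
  have hR : 0 < (R.card : ℝ) := by
    rw [Nat.cast_pos, Finset.card_pos]
    exact ⟨v₀, (outBall_finite hG v₀ k).mem_toFinset.2 (outBall_mono G v₀ (Nat.zero_le k) rfl)⟩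
  set δ : ℝ := 1 / (2 * R.card) with hδ
  have hδ0 : 0 < δ := by positivity
  -- Pigeonhole: one vertex `v` carries a fixed part of the mass for infinitely many `N`.
  obtain ⟨v, hv⟩ : ∃ v, ∃ᶠ N in atTop,
      δ ≤ openMass p (ballLabels hG v₀ t N) (traceLawAt hG μ t k N v) ω ∧
      ∑ a ∈ ballLabels hG v₀ t N,
        openMassAt p (ballLabels hG v₀ t N) (traceLaw hG μ t k N) a ω ^ 2 ≤ 1 := by
    by_contra hcon
    simp only [not_exists, not_frequently] at hcon
    have hall := (eventually_all_finset R).2 fun v _ => hcon v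
    obtain ⟨N, ⟨h1, h2⟩, h3⟩ := (hω.and_eventually hall).exists
    rw [← sum_openMass_traceLawAt] at h1
    have : ∑ v ∈ R, openMass p (ballLabels hG v₀ t N) (traceLawAt hG μ t k N v) ω < ∑ v ∈ R, δ := by
      refine Finset.sum_lt_sum_of_nonempty (Finset.card_pos.1 (by exact_mod_cast hR)) fun v hv => ?_
      by_contra hlt
      exact h3 v hv ⟨not_lt.1 hlt, h2⟩
    rw [Finset.sum_const, nsmul_eq_mul, hδ] at this
    have h4 : (R.card : ℝ) * (1 / (2 * R.card)) = 1 / 2 := by field_simp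
    rw [h4] at this
    exact absurd this (not_lt.2 h1)
  have hw : ∀ N S, 0 ≤ traceLawAt hG μ t k N v S := fun _ _ => measureReal_nonneg
  have hpath : ∀ N S, traceLawAt hG μ t k N v S ≠ 0 →
      ∃ φ : PathsToInfinity G v₀, φ.1 k = v ∧ ballTrace hG t k N φ = S := by
    intro N S h
    by_contra hcon
    push Not at hcon
    refine h ?_
    have : {φ : PathsToInfinity G v₀ | φ.1 k = v ∧ ballTrace hG t k N φ = S} = ∅ := by
      ext φ
      simpa using hcon φ
    rw [traceLawAt, this, measureReal_empty]
  have htrace : ∀ {N} {φ : PathsToInfinity G v₀} {j}, k ≤ j → φ.1 j ∈ outBall G v₀ N →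
      t (φ.1 j) (φ.1 (j + 1)) ∈ ballTrace hG t k N φ := fun {N φ j} hkj hj =>
    Finset.mem_filter.2 ⟨mem_ballLabels.2 ⟨_, hj, _, φ.2.2.1 j, rfl⟩, j, hkj, rfl⟩
  obtain ⟨b, hvb, hb⟩ : ∃ b, G.Adj v b ∧ t v b ∈ ω := by
    obtain ⟨N, ⟨h1, -⟩, hN⟩ := (hv.and_eventually (eventually_ge_atTop k)).exists
    have hne : openMass p (ballLabels hG v₀ t N) (traceLawAt hG μ t k N v) ω ≠ 0 :=
      (hδ0.trans_le h1).ne'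
    obtain ⟨S, -, hS⟩ := Finset.exists_ne_zero_of_sum_ne_zero hne
    obtain ⟨φ, rfl, rfl⟩ := hpath N S (left_ne_zero_of_mul hS)
    refine ⟨φ.1 (k + 1), φ.2.2.1 k, ?_⟩
    have hopen : ((ballTrace hG t k N φ : Finset α) : Set α) ⊆ ω := by
      by_contra hcon
      exact right_ne_zero_of_mul hS (if_neg hcon)
    exact hopen (htrace le_rfl (outBall_mono G v₀ hN (φ.mem_outBall k)))
  refine ⟨v, b, hvb, hb, ?_⟩
  have hfin := neighbors_cluster_finite hG hDG v
  refine cluster_transient (hfin := hfin) ⟨(δ ^ 2)⁻¹, fun F g hg => ?_⟩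
  obtain ⟨M, hM⟩ : ∃ M, ∀ x ∈ F, ∀ n, x ∈ outBall G v₀ n → x ∈ outBall G v₀ M := by
    have : ∀ x, ∃ M, ∀ n, x ∈ outBall G v₀ n → x ∈ outBall G v₀ M := by
      intro x
      by_cases h : ∃ n, x ∈ outBall G v₀ n
      · obtain ⟨n, hn⟩ := h
        exact ⟨n, fun _ _ => hn⟩
      · exact ⟨0, fun n hn => (h ⟨n, hn⟩).elim⟩
    choose κ hκ using this
    exact ⟨F.sup κ, fun x hx n hn => outBall_mono G v₀ (Finset.le_sup hx) (hκ x n hn)⟩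
  obtain ⟨N, ⟨h1, h2⟩, hN⟩ := (hv.and_eventually (eventually_ge_atTop (M + 1))).exists
  have key := sq_mul_openMass_le hp (ballLabels hG v₀ t N) (hw N) ω
    (labelGradient (cluster D v) hfin t F g) (abs_nonneg (g v)) ?_
  · have hE : ∑ a ∈ ballLabels hG v₀ t N,
        openMassAt p (ballLabels hG v₀ t N) (traceLawAt hG μ t k N v) a ω ^ 2 ≤ 1 := by
      refine (Finset.sum_le_sum fun a _ => ?_).trans h2
      exact pow_le_pow_left₀ (openMassAt_nonneg hp _ (hw N) a ω)
        (openMassAt_mono hp _ (traceLawAt_le hG μ t k N v) a ω) 2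
    have hgrad := sum_labelGradient_sq_le (cluster D v) hfin t F g (ballLabels hG v₀ t N)
    have h5 : (|g v| * δ) ^ 2 ≤ (cluster D v).energy hfin F g := by
      calc (|g v| * δ) ^ 2 ≤ (|g v| * openMass p (ballLabels hG v₀ t N)
            (traceLawAt hG μ t k N v) ω) ^ 2 := by gcongr
        _ ≤ _ := key
        _ ≤ (∑ a ∈ ballLabels hG v₀ t N, labelGradient (cluster D v) hfin t F g a ^ 2) * 1 :=
            mul_le_mul_of_nonneg_left hE (Finset.sum_nonneg fun _ _ => sq_nonneg _)
        _ ≤ _ := by rwa [mul_one]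
    rw [mul_pow, sq_abs] at h5
    rw [inv_mul_eq_div, le_div_iff₀ (by positivity)]
    exact h5
  · intro S _ hS hSω
    obtain ⟨φ, hφk, rfl⟩ := hpath N S hS
    refine abs_le_sum_labelGradient ht hD hfin hg (φ := fun j => φ.1 (k + j)) hφk
      (fun n => φ.2.2.1 (k + n)) (fun x => ?_) hSω fun j hj => ?_
    · exact (φ.2.2.2 x).preimage (f := fun j => k + j) (fun _ _ _ _ h => Nat.add_left_cancel h)
    · have hj' := hM _ hj _ (φ.mem_outBall (k + j))
      exact ⟨htrace (by omega) (outBall_mono G v₀ (by omega) hj'),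
        htrace (j := k + j + 1) (by omega)
          (outBall_mono G v₀ hN (Or.inr ⟨_, hj', φ.2.2.1 (k + j)⟩))⟩

/-- The common form of all four cases. Percolation acts on labels: the label `t a b` of the arc
`(a, b)` is the arc itself for oriented bond percolation, the edge `s(a, b)` for ordinary bond
percolation and the vertex `a` for site percolation. The two labels in `hD` are needed for site
percolation, where an arc is open if the labels of the arc and of some arc that follows it are. -/
theorem ae_exists_transient_cluster {α : Type*} {t : V → V → α}
    (ht : ∀ a b c d, t a b = t c d → a = c ∨ a = d) {G : Digraph V} (hG : LocFinite G)
    {u : Set α} (hu : ∀ a b, G.Adj a b → t a b ∈ u) {D : Set α → Digraph V}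
    (hDG : ∀ ω a b, (D ω).Adj a b → G.Adj a b)
    (hD : ∀ ω a b c, G.Adj a b → G.Adj b c → t a b ∈ ω → t b c ∈ ω → (D ω).Adj a b)
    {θ : ℝ} (hθ0 : 0 < θ) (hθ1 : θ < 1) {p : unitInterval} (hp : θ < (p : ℝ))
    (hEIT : AdmitsEIT G (fun φ => Set.range fun n => t (φ n) (φ (n + 1))) θ) :
    ∀ᵐ ω ∂(setBernoulli u p), ∃ v b, G.Adj v b ∧ t v b ∈ ω ∧ (cluster (D ω) v).Transient := by
  classical
  obtain ⟨v₀, μ, hμ, C, hC⟩ := hEIT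
  have hp0 : 0 < (p : ℝ) := hθ0.trans hp
  have hmeet : ∀ k n, tailMeet t μ k n ≤ |C| * θ ^ n := tailMeet_le hθ0 hC
  set Φ : ℕ → ℝ := fun k => ∑' n : ℕ, n * ((p : ℝ) ^ n)⁻¹ * tailMeet t μ k n with hΦ
  have hΦlim : Tendsto (fun k => ENNReal.ofReal (5 * Φ k)) atTop (𝓝 0) := by
    have := ENNReal.tendsto_ofReal
      ((tendsto_tsum_tailMeet ht hG hθ0 hθ1 hp hmeet).const_mul 5)
    simpa using this
  set bad : ℕ → ℕ → Set (Set α) := fun k N => {ω | ¬ (1 / 2 ≤ openMass (p : ℝ)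
    (ballLabels hG v₀ t N) (traceLaw hG μ t k N) ω ∧ ∑ a ∈ ballLabels hG v₀ t N,
      openMassAt (p : ℝ) (ballLabels hG v₀ t N) (traceLaw hG μ t k N) a ω ^ 2 ≤ 1)} with hbad
  have hbadle : ∀ k N, (setBernoulli u p) (bad k N) ≤ ENNReal.ofReal (5 * Φ k) := by
    intro k N
    have hBu : ((ballLabels hG v₀ t N : Finset α) : Set α) ⊆ u := by
      intro a ha
      obtain ⟨x, -, y, hxy, rfl⟩ := mem_ballLabels.1 ha
      exact hu x y hxy
    refine (setBernoulli_openMass_bad_le hp0 hBu (fun _ => measureReal_nonneg)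
      (sum_traceLaw hG μ t k N)).trans (ENNReal.ofReal_le_ofReal ?_)
    refine mul_le_mul_of_nonneg_left ?_ (by norm_num)
    refine pairEnergy_le_tsum μ hp0 _ _ (measurableSet_ballTrace hG t k N) _ (fun n => ?_) ?_
    · refine measureReal_mono fun q hq => ?_
      rw [Set.mem_ofPred_eq] at hq ⊢
      refine le_trans (b := ((ballTrace hG t k N q.1 ∩ ballTrace hG t k N q.2 : Finset α) :
        Set α).encard) ?_ (Set.encard_le_encard ?_)
      · rw [Set.encard_coe_eq_coe_finsetCard]
        exact_mod_cast hq
      · intro a ha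
        have ha' := Finset.mem_inter.1 (Finset.mem_coe.1 ha)
        exact ⟨(Finset.mem_filter.1 ha'.1).2, (Finset.mem_filter.1 ha'.2).2⟩
    · refine Summable.of_nonneg_of_le (fun n => ?_) (fun n => ?_)
        (summable_mul_inv_pow_mul hθ0 hp |C|)
      · have : 0 ≤ tailMeet t μ k n := measureReal_nonneg
        positivity
      · exact mul_le_mul_of_nonneg_left (hmeet k n) (by positivity)
  rw [ae_iff]
  refine le_antisymm (ge_of_tendsto' hΦlim fun k => ?_) zero_le
  -- Without a transient cluster, the bad events of index `k` hold from some `N` on.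
  calc (setBernoulli u p) {ω | ¬ ∃ v b, G.Adj v b ∧ t v b ∈ ω ∧ (cluster (D ω) v).Transient}
      ≤ (setBernoulli u p) (⋃ M, ⋂ N ≥ M, bad k N) := by
        refine measure_mono fun ω hω => ?_
        have := mt (exists_transient_of_frequently ht hG (hDG ω) (hD ω) μ hp0.le k) hω
        obtain ⟨M, hM⟩ := eventually_atTop.1 (not_frequently.1 this)
        exact Set.mem_iUnion.2 ⟨M, Set.mem_iInter₂.2 hM⟩
    _ = ⨆ M, (setBernoulli u p) (⋂ N ≥ M, bad k N) :=
        Monotone.measure_iUnion fun M M' h =>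
          Set.biInter_mono (fun _ hN => h.trans hN) fun _ _ => le_rfl
    _ ≤ ENNReal.ofReal (5 * Φ k) := iSup_le fun M =>
        (measure_mono (Set.biInter_subset_of_mem (le_refl M))).trans (hbadle k M)

theorem locFinite_bidirected {G : SimpleGraph V} (hG : ∀ v, (G.neighborSet v).Finite) :
    LocFinite (bidirected G) :=
  fun v => ⟨hG v, (hG v).subset fun _ h => G.adj_symm h⟩

end PathPercolation

theorem proposition2 {V : Type*} (θ : ℝ) (hθ0 : 0 < θ) (hθ1 : θ < 1)
    (p : unitInterval) (hp : θ < (p : ℝ)) :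
    -- oriented (bond) percolation on a directed graph
    (∀ G : Digraph V, PathPercolation.LocFinite G →
      PathPercolation.AdmitsEIT G PathPercolation.pathArcs θ →
      ∀ᵐ ω ∂(setBernoulli (PathPercolation.arcs G) p), ∃ v : V,
        (PathPercolation.cluster (PathPercolation.openArcs G ω) v).Transient) ∧
    -- oriented site percolation on a directed graph
    (∀ G : Digraph V, PathPercolation.LocFinite G →
      PathPercolation.AdmitsEIT G PathPercolation.pathVerts θ →
      ∀ᵐ ω ∂(setBernoulli (Set.univ : Set V) p), ∃ v ∈ ω,
        (PathPercolation.cluster (PathPercolation.openSites G ω) v).Transient) ∧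
    -- ordinary bond percolation on an undirected graph
    (∀ G : SimpleGraph V, (∀ v, (G.neighborSet v).Finite) →
      PathPercolation.AdmitsEIT (PathPercolation.bidirected G) PathPercolation.pathEdges θ →
      ∀ᵐ ω ∂(setBernoulli G.edgeSet p), ∃ v : V,
        (PathPercolation.cluster (PathPercolation.openEdges G ω) v).Transient) ∧
    -- ordinary site percolation on an undirected graph
    (∀ G : SimpleGraph V, (∀ v, (G.neighborSet v).Finite) →
      PathPercolation.AdmitsEIT (PathPercolation.bidirected G) PathPercolation.pathVerts θ →
      ∀ᵐ ω ∂(setBernoulli (Set.univ : Set V) p), ∃ v ∈ ω,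
        (PathPercolation.cluster
          (PathPercolation.openSites (PathPercolation.bidirected G) ω) v).Transient) := by
  refine ⟨fun G hG h => ?_, fun G hG h => ?_, fun G hG h => ?_, fun G hG h => ?_⟩
  · refine (PathPercolation.ae_exists_transient_cluster (t := Prod.mk)
      (D := PathPercolation.openArcs G) (fun a b c d h => Or.inl (Prod.ext_iff.1 h).1) hG
      (fun _ _ h => h) (fun _ _ _ h => h.1) (fun _ _ _ _ h _ h' _ => ⟨h, h'⟩)
      hθ0 hθ1 hp h).mono ?_
    rintro ω ⟨v, -, -, -, hv⟩
    exact ⟨v, hv⟩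
  · refine (PathPercolation.ae_exists_transient_cluster (t := fun a _ => a)
      (D := PathPercolation.openSites G) (fun a b c d h => Or.inl h) hG
      (fun _ _ _ => trivial) (fun _ _ _ h => h.1) (fun _ _ _ _ h _ ha hb => ⟨h, ha, hb⟩)
      hθ0 hθ1 hp h).mono ?_
    rintro ω ⟨v, -, -, hvω, hv⟩
    exact ⟨v, hvω, hv⟩
  · refine (PathPercolation.ae_exists_transient_cluster (t := fun a b => s(a, b))
      (D := PathPercolation.openEdges G) (fun a b c d h => ?_)
      (PathPercolation.locFinite_bidirected hG) (fun _ _ h => h) (fun _ _ _ h => h.1)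
      (fun _ _ _ _ h _ h' _ => ⟨h, h'⟩) hθ0 hθ1 hp h).mono ?_
    · exact (Sym2.eq_iff.1 h).imp And.left And.left
    · rintro ω ⟨v, -, -, -, hv⟩
      exact ⟨v, hv⟩
  · refine (PathPercolation.ae_exists_transient_cluster (t := fun a _ => a)
      (D := PathPercolation.openSites (PathPercolation.bidirected G)) (fun a b c d h => Or.inl h)
      (PathPercolation.locFinite_bidirected hG)
      (fun _ _ _ => trivial) (fun _ _ _ h => h.1) (fun _ _ _ _ h _ ha hb => ⟨h, ha, hb⟩)
      hθ0 hθ1 hp h).mono ?_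
    rintro ω ⟨v, -, -, hvω, hv⟩
    exact ⟨v, hvω, hv⟩
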